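/- Let $N\ge 2$ and $1\le k\le N-1$. For $m\ge 1$ let $\Omega_m=\{q\in\mathbb{R}^m : q_1>q_2>\dots>q_m\}$, let $h(q)=(e^{-|q_i-q_j|})_{i,j=1,\dots,m}$ and let $g=h^{-1}$, the Riemannian metric on $\Omega_m$ whose geodesics describe $m$-peakon solutions of the Camassa–Holm equation. Parametrize the singular set $\{q_k=q_{k+1}\}\subset\mathbb{R}^N$ by the linear map $\iota(y_1,\dots,y_{N-1})=(y_1,\dots,y_{k-1},y_k,y_k,y_{k+1},\dots,y_{N-1})$. (a) The restriction $\tilde g$ of $g$ to the singular set is a well-defined metric: for every $y\in\Omega_{N-1}$ and all $u,w\in\mathbb{R}^{N-1}$ the limit $$\tilde g_y(u,w)=\lim_{x\to\iota(y),\ x\in\Omega_N} g_x(\iota u,\iota w)$$ exists and is finite, and $\tilde g$ is a (smooth, positive definite) Riemannian metric on $\Omega_{N-1}$. (b) Let $t\mapsto q(t)\in\Omega_N$, $t\in(a,t^*)$, $-\infty<a<t^*<\infty$, be a geodesic of $g$ that approaches the singular set $\{q_k=q_{k+1}\}$, and no other collision set, at time $t^*$: $q_k(t)-q_{k+1}(t)\to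 0$ as $t\to t^*$, whereas $q_j(t)-q_{j+1}(t)\not\to 0$ for every $j\ne k$. Let $p(t)=g(\dot q(t),\cdot)$ be the associated covector. Then the limits $$\lim_{t\to t^*}\bigl(p_k(t)+p_{k+1}(t)\bigr)\qquad\text{and}\qquad \lim_{t\to t^*}p_j(t),\quad j\ne k,k+1,$$ exist and are finite. Moreover $q(t)$ converges to a point $\iota(y)$ with $y\in\Omega_{N-1}$, and the limit $V=\lim_{t\to t^*}\dot q(t)$ exists and is tangent to the singular set, that is, $V_k=V_{k+1}$ and $V=\iota(v)$ for some $v\in\mathbb{R}^{N-1}$. Finally, $\tilde g_y(v,v)\le g_{q(t)}(\dot q(t),\dot q(t))$ for all $t\in(a,t^*)$, i.e. $\tilde g(V,V)\le g(\dot q,\dot q)$. -/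

import Mathlib

open Set Filter Topology Matrix
open scoped ContDiff

noncomputable section

/-- The configurations `q₁ > q₂ > ⋯ > q_m` of `m` peakons at distinct, ordered positions. -/
def orderedRegion (m : ℕ) : Set (Fin m → ℝ) := {x | StrictAnti x}

/-- The matrix `h(q) = (e^{-|q_i - q_j|})`. -/
def peakonCometric {m : ℕ} (x : Fin m → ℝ) : Matrix (Fin m) (Fin m) ℝ :=
  Matrix.of fun i j => Real.exp (-|x i - x j|)

/-- The peakon metric `g(q) = h(q)⁻¹`, as a matrix in the coordinates `q`. -/
def peakonMetric {m : ℕ} (x : Fin m → ℝ) : Matrix (Fin m) (Fin m) ℝ :=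
  (peakonCometric x)⁻¹

/-- The value `A(u, w) = ∑ u_i A_ij w_j` of the bilinear form with matrix `A`. -/
def formValue {m : ℕ} (A : Matrix (Fin m) (Fin m) ℝ) (u w : Fin m → ℝ) : ℝ :=
  u ⬝ᵥ (A *ᵥ w)

/-- The partial derivative `∂_l G_ij` of a matrix-valued function at `x`. -/
def partialEntry {m : ℕ} (G : (Fin m → ℝ) → Matrix (Fin m) (Fin m) ℝ)
    (l i j : Fin m) (x : Fin m → ℝ) : ℝ :=
  fderiv ℝ (fun z => G z i j) x (Pi.single l 1)

/-- The Christoffel symbol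
`Γ^i_{jl} = ½ ∑_r G^{ir} (∂_j G_{rl} + ∂_l G_{rj} - ∂_r G_{jl})` of the Levi-Civita connection. -/
def christoffel {m : ℕ} (G : (Fin m → ℝ) → Matrix (Fin m) (Fin m) ℝ)
    (x : Fin m → ℝ) (i j l : Fin m) : ℝ :=
  (1 / 2) * ∑ r, (G x)⁻¹ i r *
    (partialEntry G j r l x + partialEntry G l r j x - partialEntry G r j l x)

/-- `q` is a geodesic, for times in the open set `I`, of the metric `G` on the region `U`:
it stays in `U`, is twice differentiable, and `q̈^i + ∑_{j,l} Γ^i_{jl}(q) q̇^j q̇^l = 0`. -/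
def IsGeodesicOn {m : ℕ} (G : (Fin m → ℝ) → Matrix (Fin m) (Fin m) ℝ)
    (U : Set (Fin m → ℝ)) (q : ℝ → Fin m → ℝ) (I : Set ℝ) : Prop :=
  ∀ t ∈ I, q t ∈ U ∧ DifferentiableAt ℝ q t ∧
    HasDerivAt (deriv q)
      (fun i => -∑ j, ∑ l, christoffel G (q t) i j l * deriv q t j * deriv q t l) t

/-- The covector `p(t) = g(q̇(t), ·)` along a curve `q`. -/
def momentum {m : ℕ} (q : ℝ → Fin m → ℝ) (t : ℝ) : Fin m → ℝ :=
  peakonMetric (q t) *ᵥ deriv q t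

/-- The parametrization
`(y₁, …, y_n) ↦ (y₁, …, y_{k-1}, y_k, y_k, y_{k+1}, …, y_n)` of the hyperplane
`{x_k = x_{k+1}}` in `ℝ^{n+1}`. Being linear, it is its own differential, so it also identifies
`ℝ^n` with the tangent space of the hyperplane at each point. -/
def doubling {n : ℕ} (k : Fin n) (y : Fin n → ℝ) : Fin (n + 1) → ℝ :=
  fun i => y (k.predAbove i)

/-- The restriction `g̃` of the metric `g` to `{x_k = x_{k+1}}`, in the parametrization `doubling`:
its coefficients at `y` are the limits of `g_x(∂_i, ∂_j)`, with `∂_i`, `∂_j` the coordinate vectors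
tangent to the hyperplane, as `x` approaches the point with parameter `y` from the
ordered region. -/
def restrictedMetric {n : ℕ} (k : Fin n) (y : Fin n → ℝ) : Matrix (Fin n) (Fin n) ℝ :=
  Matrix.of fun i j =>
    limUnder (𝓝[orderedRegion (n + 1)] (doubling k y)) fun x =>
      formValue (peakonMetric x) (doubling k (Pi.single i 1)) (doubling k (Pi.single j 1))

/-- `G` is a (smooth, positive definite) Riemannian metric on `U`. -/
def IsRiemannianMetricOn {m : ℕ} (G : (Fin m → ℝ) → Matrix (Fin m) (Fin m) ℝ)
    (U : Set (Fin m → ℝ)) : Prop :=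
  (∀ i j, ContDiffOn ℝ ∞ (fun x => G x i j) U) ∧ ∀ x ∈ U, (G x).PosDef

end

/-!
Let `ι = doubling k` and, for a covector `p ∈ ℝ^{n+1}`, let `ιᵀ p = mergeMomenta k p`, which replaces
`p_k` and `p_{k+1}` by their sum. In the coordinates `(ιᵀ p, p_{k+1})` the cometric `h(x)` has the
diagonal blocks `h(x')`, where `x'` is `x` without its `(k+1)`-st entry, and `c = 2 (1 - h_{k,k+1})`;
the off-diagonal block `b` consists of entries of `h e_{k+1} - h e_k`, so that `|b_j| ≤ c / 2`
(`abs_cometricColDiff_le`). Hence the Schur complement `h(x') - c⁻¹ b bᵀ` converges to the positive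
definite matrix `h(y)` as `x → ι y` (`tendsto_schurComplement`), although `h(x)` itself degenerates.

If `p = g_x (ι w)`, then eliminating `p_{k+1}` leaves `(h(x') - c⁻¹ b bᵀ) (ιᵀ p) = w`, hence
`g_x(ι u, ι w) = u · ιᵀ p → u · h(y)⁻¹ w`. So the restricted metric is the peakon metric of `n`
peakons (`restrictedMetric_eq`), in particular smooth and positive definite.

Along a geodesic the momenta obey Hamilton's equations
`ṗ_i = p_i ∑_j sgn(q_i - q_j) h_{ij} p_j` (`hasDerivAt_momentum`), so `∑ p_i` and the energy
`E = p · h p` are conserved. Since `h_{ii} = 1`, Cauchy–Schwarz gives `q̇_i² ≤ E`, and `q` converges;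
it also gives `(q̇_{k+1} - q̇_k)² ≤ c E → 0` (`tendsto_closingRate`). The same elimination now shows
that `ιᵀ p` is bounded (`isBigO_mergeMomenta`). As `q̇_{k+1} - q̇_k = b · ιᵀ p + c p_{k+1}`, it follows
that `c p_{k+1} → 0`, and therefore `b_j p_{k+1} → 0`: the momentum `p_{k+1}` may be unbounded, but it
enters everything else only through these products. Thus `ṗ_j` is bounded for `j ≠ k, k + 1` and `p_j`
converges; the sum `p_k + p_{k+1}` converges by conservation of `∑ p_i`. If `ιᵀ p → π`, then
`q̇ = h p → ι (h(y) π)`, and `E = ιᵀp · h(q') ιᵀp + 2 p_{k+1} b · ιᵀ p + c p_{k+1}²`, where the last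
term is nonnegative and the middle one vanishes in the limit, so that
`π · h(y) π = g̃_y(h(y) π, h(y) π) ≤ E`.
-/

open Asymptotics

/-! ### The cometric and the metric on the ordered region -/

theorem peakonCometric_apply {m : ℕ} (x : Fin m → ℝ) (i j : Fin m) :
    peakonCometric x i j = Real.exp (-|x i - x j|) := rfl

theorem peakonCometric_comm {m : ℕ} (x : Fin m → ℝ) (i j : Fin m) :
    peakonCometric x i j = peakonCometric x j i := by
  rw [peakonCometric_apply, peakonCometric_apply, abs_sub_comm]

theorem peakonCometric_self {m : ℕ} (x : Fin m → ℝ) (i : Fin m) :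
    peakonCometric x i i = 1 := by
  simp [peakonCometric_apply]

theorem peakonCometric_transpose {m : ℕ} (x : Fin m → ℝ) :
    (peakonCometric x)ᵀ = peakonCometric x := by
  ext i j
  exact peakonCometric_comm x j i

theorem continuous_peakonCometric {m : ℕ} :
    Continuous (peakonCometric : (Fin m → ℝ) → Matrix (Fin m) (Fin m) ℝ) := by
  refine continuous_pi fun i => continuous_pi fun j => ?_
  simp only [peakonCometric_apply]
  fun_prop

theorem isOpen_orderedRegion (m : ℕ) : IsOpen (orderedRegion m) := by
  have : orderedRegion m = ⋂ i : Fin m, ⋂ j : Fin m, {x | i < j → x j < x i} := by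
    ext x
    simp [orderedRegion, StrictAnti]
  rw [this]
  refine isOpen_iInter_of_finite fun i => isOpen_iInter_of_finite fun j => ?_
  by_cases h : i < j
  · simpa [h] using isOpen_lt (continuous_apply j) (continuous_apply i)
  · simp [h]

/-- In the ordered region `h_{0j} = e^{-(x_0 - x_1)} h_{1j}` for `j ≥ 1`, so completing the square
in `p_0` leaves the form of the configuration without its first peakon. -/
theorem dotProduct_peakonCometric_pos {m : ℕ} (x : Fin m → ℝ) (hx : StrictAnti x)
    (p : Fin m → ℝ) (hp : p ≠ 0) : 0 < p ⬝ᵥ (peakonCometric x *ᵥ p) := by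
  induction m with
  | zero => exact absurd (Subsingleton.elim p 0) hp
  | succ m ih =>
    rcases m with _ | m
    · have h0 : p 0 ≠ 0 := fun h => hp (by ext i; fin_cases i; exact h)
      simpa [dotProduct, mulVec, peakonCometric_apply] using h0
    · set E := Real.exp (-(x 0 - x 1)) with hE
      have h01 : x 1 < x 0 := hx (by simp)
      have hE1 : E < 1 := by
        rw [hE, Real.exp_lt_one_iff]; linarith
      have hE0 : 0 < E := Real.exp_pos _
      have hxt : StrictAnti (x ∘ Fin.succ) := hx.comp_strictMono (Fin.strictMono_succ)
      set r : Fin (m + 1) → ℝ := (p ∘ Fin.succ) + Pi.single 0 (E * p 0) with hr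
      have hrow : ∀ j : Fin (m + 1),
          peakonCometric x 0 j.succ = E * peakonCometric (x ∘ Fin.succ) 0 j := by
        intro j
        have h1 : x j.succ ≤ x 1 := hx.antitone (by simp [Fin.le_def])
        simp only [peakonCometric_apply, hE, ← Real.exp_add, Function.comp]
        rw [abs_of_pos (by linarith), abs_of_nonneg (by simpa using h1)]
        congr 1
        simp
      have key : p ⬝ᵥ (peakonCometric x *ᵥ p) =
          (1 - E ^ 2) * p 0 ^ 2 + r ⬝ᵥ (peakonCometric (x ∘ Fin.succ) *ᵥ r) := by
        have e1 : r ⬝ᵥ (peakonCometric (x ∘ Fin.succ) *ᵥ r) =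
            (p ∘ Fin.succ) ⬝ᵥ (peakonCometric (x ∘ Fin.succ) *ᵥ (p ∘ Fin.succ)) +
              2 * (E * p 0) * (peakonCometric (x ∘ Fin.succ) *ᵥ (p ∘ Fin.succ)) 0 +
              (E * p 0) ^ 2 := by
          have h2 : (p ∘ Fin.succ) ⬝ᵥ
              (peakonCometric (x ∘ Fin.succ) *ᵥ (Pi.single 0 (E * p 0))) =
              (E * p 0) * (peakonCometric (x ∘ Fin.succ) *ᵥ (p ∘ Fin.succ)) 0 := by
            rw [dotProduct_mulVec, ← mulVec_transpose, peakonCometric_transpose,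
              dotProduct_single, mul_comm]
          rw [hr, mulVec_add, add_dotProduct, dotProduct_add, dotProduct_add, h2,
            single_dotProduct, single_dotProduct]
          have h3 : (peakonCometric (x ∘ Fin.succ) *ᵥ (Pi.single 0 (E * p 0))) 0 = E * p 0 := by
            simp [mulVec, dotProduct_single, peakonCometric_self]
          rw [h3]
          ring
        rw [e1]
        simp only [dotProduct, mulVec, Fin.sum_univ_succ (n := m + 1), peakonCometric_self, hrow,
          fun j : Fin (m + 1) => peakonCometric_comm x j.succ 0]
        have h4 : ∀ i j : Fin (m + 1), peakonCometric (x ∘ Fin.succ) i j =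
          peakonCometric x i.succ j.succ := fun i j => rfl
        simp only [← h4, mul_add, Finset.sum_add_distrib, Function.comp]
        have h5 : ∑ j : Fin (m + 1), E * peakonCometric (x ∘ Fin.succ) 0 j * p j.succ =
            E * ∑ j : Fin (m + 1), peakonCometric (x ∘ Fin.succ) 0 j * p j.succ := by
          rw [Finset.mul_sum]; exact Finset.sum_congr rfl fun j _ => by ring
        have h6 : ∑ j : Fin (m + 1), p j.succ *
            (E * peakonCometric (x ∘ Fin.succ) 0 j * p 0) =
            E * p 0 * ∑ j : Fin (m + 1), peakonCometric (x ∘ Fin.succ) 0 j * p j.succ := by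
          rw [Finset.mul_sum]; exact Finset.sum_congr rfl fun j _ => by ring
        rw [h5, h6]
        ring
      rw [key]
      by_cases h0 : p 0 = 0
      · have hr0 : r ≠ 0 := by
          intro h
          apply hp
          ext i
          refine Fin.cases h0 (fun j => ?_) i
          have := congrFun h j
          simpa [hr, h0] using this
        have := ih _ hxt r hr0
        rw [h0]
        simpa using this
      · have hnn : 0 ≤ r ⬝ᵥ (peakonCometric (x ∘ Fin.succ) *ᵥ r) := by
          by_cases hr0 : r = 0
          · simp [hr0]
          · exact (ih _ hxt r hr0).le
        have : 0 < (1 - E ^ 2) * p 0 ^ 2 := by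
          have : E ^ 2 < 1 := by nlinarith
          have := sq_pos_of_ne_zero h0
          apply mul_pos <;> linarith
        linarith

theorem posDef_peakonCometric {m : ℕ} {x : Fin m → ℝ} (hx : x ∈ orderedRegion m) :
    (peakonCometric x).PosDef :=
  Matrix.PosDef.of_dotProduct_mulVec_pos
    (by rw [IsHermitian, conjTranspose_eq_transpose_of_trivial, peakonCometric_transpose])
    fun p hp => by simpa using dotProduct_peakonCometric_pos x hx p hp

theorem isUnit_det_peakonCometric {m : ℕ} {x : Fin m → ℝ} (hx : x ∈ orderedRegion m) :
    IsUnit (peakonCometric x).det :=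
  (posDef_peakonCometric hx).det_pos.ne'.isUnit

theorem posDef_peakonMetric {m : ℕ} {x : Fin m → ℝ} (hx : x ∈ orderedRegion m) :
    (peakonMetric x).PosDef :=
  (posDef_peakonCometric hx).inv

theorem peakonCometric_mulVec_peakonMetric_mulVec {m : ℕ} {x : Fin m → ℝ}
    (hx : x ∈ orderedRegion m) (u : Fin m → ℝ) :
    peakonCometric x *ᵥ (peakonMetric x *ᵥ u) = u := by
  rw [mulVec_mulVec, peakonMetric, mul_nonsing_inv _ (isUnit_det_peakonCometric hx), one_mulVec]

theorem peakonMetric_transpose {m : ℕ} (x : Fin m → ℝ) :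
    (peakonMetric x)ᵀ = peakonMetric x := by
  rw [peakonMetric, transpose_nonsing_inv, peakonCometric_transpose]

theorem injective_of_mem_orderedRegion {m : ℕ} {x : Fin m → ℝ} (hx : x ∈ orderedRegion m) :
    Function.Injective x :=
  StrictAnti.injective hx

theorem contDiffOn_peakonCometric {m : ℕ} (i j : Fin m) :
    ContDiffOn ℝ ∞ (fun x => peakonCometric x i j) (orderedRegion m) := by
  by_cases hij : i = j
  · subst hij
    simp only [peakonCometric_self]
    exact contDiffOn_const
  · intro x hx
    have hne : x i - x j ≠ 0 := sub_ne_zero.2 fun h => hij (injective_of_mem_orderedRegion hx h)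
    have h1 : ContDiffAt ℝ ∞ (fun z : Fin m → ℝ => z i - z j) x := by fun_prop
    exact ((contDiffAt_abs hne).comp x h1).neg.exp.contDiffWithinAt

theorem contDiffOn_det {E : Type*} [NormedAddCommGroup E] [NormedSpace ℝ E] {m : ℕ} {s : Set E}
    {A : E → Matrix (Fin m) (Fin m) ℝ} (hA : ∀ i j, ContDiffOn ℝ ∞ (fun x => A x i j) s) :
    ContDiffOn ℝ ∞ (fun x => (A x).det) s := by
  simp only [det_apply]
  refine ContDiffOn.sum fun σ _ => ?_
  exact (contDiffOn_prod fun i _ => hA (σ i) i).const_smul _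

theorem contDiffOn_peakonMetric {m : ℕ} (i j : Fin m) :
    ContDiffOn ℝ ∞ (fun x => peakonMetric x i j) (orderedRegion m) := by
  have h1 : (fun x : Fin m → ℝ => peakonMetric x i j) =
      fun x => (peakonCometric x).det⁻¹ *
        ((peakonCometric x).updateRow j (Pi.single i 1)).det := by
    ext x
    rw [peakonMetric, inv_def, Ring.inverse_eq_inv', Matrix.smul_apply, adjugate_apply, smul_eq_mul]
  rw [h1]
  refine ((contDiffOn_det contDiffOn_peakonCometric).inv fun x hx =>
    (posDef_peakonCometric hx).det_pos.ne').mul (contDiffOn_det fun r c => ?_)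
  by_cases hr : r = j
  · subst hr
    simp only [updateRow_self]
    exact contDiffOn_const
  · simp only [updateRow_ne hr]
    exact contDiffOn_peakonCometric r c

/-- Cauchy–Schwarz for the positive semidefinite form `h(x)`. -/
theorem sq_dotProduct_le_of_mem_orderedRegion {m : ℕ} {x : Fin m → ℝ} (hx : x ∈ orderedRegion m)
    (e p : Fin m → ℝ) :
    (e ⬝ᵥ (peakonCometric x *ᵥ p)) ^ 2 ≤
      (e ⬝ᵥ (peakonCometric x *ᵥ e)) * (p ⬝ᵥ (peakonCometric x *ᵥ p)) := by
  have hsymm : p ⬝ᵥ (peakonCometric x *ᵥ e) = e ⬝ᵥ (peakonCometric x *ᵥ p) := by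
    rw [dotProduct_mulVec, ← mulVec_transpose, peakonCometric_transpose, dotProduct_comm]
  have h0 : ∀ s : ℝ, 0 ≤ (e ⬝ᵥ (peakonCometric x *ᵥ e)) * (s * s) +
      (2 * (e ⬝ᵥ (peakonCometric x *ᵥ p))) * s + p ⬝ᵥ (peakonCometric x *ᵥ p) := by
    intro s
    have h := (posDef_peakonCometric hx).posSemidef.dotProduct_mulVec_nonneg (s • e + p)
    simp only [star_trivial, mulVec_add, mulVec_smul, add_dotProduct, dotProduct_add,
      smul_dotProduct, dotProduct_smul, smul_eq_mul, hsymm] at h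
    linarith
  have := discrim_le_zero h0
  rw [discrim] at this
  linarith

/-! ### Merging two adjacent peakons -/

theorem doubling_succ {n : ℕ} (k : Fin n) (y : Fin n → ℝ) : doubling k y k.succ = y k := by
  simp [doubling]

theorem doubling_castSucc {n : ℕ} (k : Fin n) (y : Fin n → ℝ) :
    doubling k y k.castSucc = y k := by
  simp [doubling]

theorem predAbove_succ_succAbove {n : ℕ} (k l : Fin n) :
    k.predAbove (k.succ.succAbove l) = l := by
  rcases le_or_gt l k with h | h
  · rw [Fin.succAbove_succ_of_le _ _ h, Fin.predAbove_castSucc_of_le _ _ h]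
  · rw [Fin.succAbove_succ_of_lt _ _ h, Fin.predAbove_succ_of_le _ _ h.le]

theorem doubling_succAbove {n : ℕ} (k : Fin n) (y : Fin n → ℝ) (l : Fin n) :
    doubling k y (k.succ.succAbove l) = y l := by
  rw [doubling, predAbove_succ_succAbove]

theorem eq_doubling {n : ℕ} {k : Fin n} {x : Fin (n + 1) → ℝ} (h : x k.castSucc = x k.succ) :
    x = doubling k (x ∘ k.succ.succAbove) := by
  ext i
  rcases Fin.eq_self_or_eq_succAbove k.succ i with rfl | ⟨l, rfl⟩
  · rw [doubling_succ, Function.comp, Fin.succAbove_succ_self, h]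
  · rw [doubling_succAbove]; rfl

/-- The covector obtained from `p` by adding the momenta of the peakons `k` and `k + 1`: the
restriction of the linear form `p` to the hyperplane `{x_k = x_{k+1}}`, in the parametrization
`doubling`. -/
def mergeMomenta {n : ℕ} (k : Fin n) (p : Fin (n + 1) → ℝ) : Fin n → ℝ :=
  p ∘ k.succ.succAbove + Pi.single k (p k.succ)

/-- A linear form in `p`, in terms of the merged momenta and of `p_{k+1}` alone. -/
theorem dotProduct_eq_merge {n : ℕ} (k : Fin n) (f p : Fin (n + 1) → ℝ) :
    f ⬝ᵥ p = (f ∘ k.succ.succAbove) ⬝ᵥ mergeMomenta k p +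
      (f k.succ - f k.castSucc) * p k.succ := by
  rw [mergeMomenta, dotProduct_add, dotProduct_single, dotProduct,
    Fin.sum_univ_succAbove _ k.succ]
  simp only [Function.comp, Fin.succAbove_succ_self, dotProduct]
  ring

theorem doubling_dotProduct {n : ℕ} (k : Fin n) (u : Fin n → ℝ) (p : Fin (n + 1) → ℝ) :
    doubling k u ⬝ᵥ p = u ⬝ᵥ mergeMomenta k p := by
  rw [dotProduct_eq_merge k, doubling_succ, doubling_castSucc, sub_self, zero_mul, add_zero]
  congr 1
  exact funext (doubling_succAbove k u)

/-- The difference `h e_{k+1} - h e_k` of two columns of the cometric. -/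
noncomputable def cometricColDiff {n : ℕ} (k : Fin n) (x : Fin (n + 1) → ℝ) : Fin (n + 1) → ℝ :=
  fun i => peakonCometric x i k.succ - peakonCometric x i k.castSucc

/-- The squared length `2 (1 - h_{k,k+1})` of the covector `e_{k+1} - e_k`. -/
noncomputable def gapNorm {n : ℕ} (k : Fin n) (x : Fin (n + 1) → ℝ) : ℝ :=
  2 * (1 - peakonCometric x k.castSucc k.succ)

theorem abs_exp_neg_abs_sub_le (a b c : ℝ) :
    |Real.exp (-|a - b|) - Real.exp (-|a - c|)| ≤ 1 - Real.exp (-|c - b|) := by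
  have key : ∀ b c : ℝ, Real.exp (-|a - c|) - Real.exp (-|a - b|) ≤ 1 - Real.exp (-|c - b|) := by
    intro b c
    have h1 : Real.exp (-|a - c|) * Real.exp (-|c - b|) ≤ Real.exp (-|a - b|) := by
      rw [← Real.exp_add, Real.exp_le_exp]
      linarith [abs_sub_le a c b]
    have h2 : Real.exp (-|a - c|) ≤ 1 := by simp
    have h3 : Real.exp (-|c - b|) ≤ 1 := by simp
    nlinarith
  rw [abs_le]
  constructor
  · linarith [key b c]
  · have := key c b
    rwa [abs_sub_comm b c] at this

theorem abs_cometricColDiff_le {n : ℕ} (k : Fin n) (x : Fin (n + 1) → ℝ) (i : Fin (n + 1)) :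
    |cometricColDiff k x i| ≤ gapNorm k x / 2 := by
  have := abs_exp_neg_abs_sub_le (x i) (x k.succ) (x k.castSucc)
  simp only [cometricColDiff, gapNorm, peakonCometric_apply]
  linarith

theorem gapNorm_nonneg {n : ℕ} (k : Fin n) (x : Fin (n + 1) → ℝ) : 0 ≤ gapNorm k x := by
  linarith [abs_nonneg (cometricColDiff k x 0), abs_cometricColDiff_le k x 0]

theorem gapNorm_pos {n : ℕ} (k : Fin n) {x : Fin (n + 1) → ℝ} (hx : x ∈ orderedRegion (n + 1)) :
    0 < gapNorm k x := by
  have h1 : x k.succ < x k.castSucc := hx (Fin.castSucc_lt_succ)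
  have h2 : Real.exp (-|x k.castSucc - x k.succ|) < 1 := by
    rw [Real.exp_lt_one_iff, abs_of_pos (by linarith)]
    linarith
  rw [gapNorm, peakonCometric_apply]
  linarith

theorem gapNorm_eq {n : ℕ} (k : Fin n) (x : Fin (n + 1) → ℝ) :
    gapNorm k x = cometricColDiff k x k.succ - cometricColDiff k x k.castSucc := by
  simp only [gapNorm, cometricColDiff, peakonCometric_self, peakonCometric_comm x k.succ]
  ring

/-- The velocity `h p` in terms of the merged momenta and of `p_{k+1}`. -/
theorem peakonCometric_mulVec_eq_merge {n : ℕ} (k : Fin n) (x p : Fin (n + 1) → ℝ)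
    (i : Fin (n + 1)) :
    (peakonCometric x *ᵥ p) i =
      (fun l => peakonCometric x i (k.succ.succAbove l)) ⬝ᵥ mergeMomenta k p +
        cometricColDiff k x i * p k.succ := by
  rw [mulVec, dotProduct_eq_merge k]
  rfl

/-- The rate `(h p)_{k+1} - (h p)_k` at which the gap closes. -/
theorem mulVec_succ_sub_mulVec_castSucc {n : ℕ} (k : Fin n) (x p : Fin (n + 1) → ℝ) :
    (peakonCometric x *ᵥ p) k.succ - (peakonCometric x *ᵥ p) k.castSucc =
      (cometricColDiff k x ∘ k.succ.succAbove) ⬝ᵥ mergeMomenta k p +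
        gapNorm k x * p k.succ := by
  rw [peakonCometric_mulVec_eq_merge k, peakonCometric_mulVec_eq_merge k, gapNorm_eq]
  have : cometricColDiff k x ∘ k.succ.succAbove =
      (fun l => peakonCometric x k.succ (k.succ.succAbove l)) -
        fun l => peakonCometric x k.castSucc (k.succ.succAbove l) := by
    ext l
    simp [cometricColDiff, peakonCometric_comm x (k.succ.succAbove l)]
  rw [this, sub_dotProduct]
  ring

/-- The energy `p · h p` in terms of the merged momenta and of `p_{k+1}`. -/
theorem dotProduct_mulVec_eq_merge {n : ℕ} (k : Fin n) (x p : Fin (n + 1) → ℝ) :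
    p ⬝ᵥ (peakonCometric x *ᵥ p) =
      mergeMomenta k p ⬝ᵥ (peakonCometric (x ∘ k.succ.succAbove) *ᵥ mergeMomenta k p) +
        2 * p k.succ * ((cometricColDiff k x ∘ k.succ.succAbove) ⬝ᵥ mergeMomenta k p) +
        gapNorm k x * p k.succ ^ 2 := by
  rw [dotProduct_comm, dotProduct_eq_merge k, mulVec_succ_sub_mulVec_castSucc]
  have : (peakonCometric x *ᵥ p) ∘ k.succ.succAbove =
      peakonCometric (x ∘ k.succ.succAbove) *ᵥ mergeMomenta k p +
        p k.succ • (cometricColDiff k x ∘ k.succ.succAbove) := by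
    ext l
    simp only [Function.comp, peakonCometric_mulVec_eq_merge k, Pi.add_apply, Pi.smul_apply,
      smul_eq_mul]
    rw [mul_comm (p k.succ)]
    rfl
  rw [this, add_dotProduct, smul_dotProduct, dotProduct_comm]
  simp only [smul_eq_mul]
  ring

/-- The Schur complement of `gapNorm k x` in the cometric, written in the dual coordinates
`(mergeMomenta k p, p_{k+1})`. Where the gap closes, `gapNorm` vanishes and so does the subtracted
term, by the convention `a / 0 = 0`. -/
noncomputable def schurComplement {n : ℕ} (k : Fin n) (x : Fin (n + 1) → ℝ) : Matrix (Fin n) (Fin n) ℝ :=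
  peakonCometric (x ∘ k.succ.succAbove) -
    Matrix.of fun i j => cometricColDiff k x (k.succ.succAbove i) *
      cometricColDiff k x (k.succ.succAbove j) / gapNorm k x

/-- Elimination of `p_{k+1}` from the linear system `h p = w`. -/
theorem schurComplement_mulVec_mergeMomenta {n : ℕ} (k : Fin n) {x : Fin (n + 1) → ℝ}
    (hx : x ∈ orderedRegion (n + 1)) (p : Fin (n + 1) → ℝ) (i : Fin n) :
    (schurComplement k x *ᵥ mergeMomenta k p) i =
      (peakonCometric x *ᵥ p) (k.succ.succAbove i) -
        cometricColDiff k x (k.succ.succAbove i) / gapNorm k x *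
          ((peakonCometric x *ᵥ p) k.succ - (peakonCometric x *ᵥ p) k.castSucc) := by
  have hc := (gapNorm_pos k hx).ne'
  have h1 : (Matrix.of fun i j => cometricColDiff k x (k.succ.succAbove i) *
      cometricColDiff k x (k.succ.succAbove j) / gapNorm k x) *ᵥ mergeMomenta k p =
      fun i => cometricColDiff k x (k.succ.succAbove i) / gapNorm k x *
        ((cometricColDiff k x ∘ k.succ.succAbove) ⬝ᵥ mergeMomenta k p) := by
    ext i
    simp only [mulVec, dotProduct, of_apply, Finset.mul_sum, Function.comp]
    exact Finset.sum_congr rfl fun j _ => by ring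
  rw [mulVec_succ_sub_mulVec_castSucc, peakonCometric_mulVec_eq_merge k, schurComplement,
    sub_mulVec, h1]
  have h2 : (peakonCometric (x ∘ k.succ.succAbove) *ᵥ mergeMomenta k p) i =
      (fun l => peakonCometric x (k.succ.succAbove i) (k.succ.succAbove l)) ⬝ᵥ
        mergeMomenta k p := rfl
  rw [Pi.sub_apply, h2]
  field_simp
  ring

theorem tendsto_comp_succAbove {n : ℕ} {k : Fin n} {α : Type*} {f : Filter α}
    {x : α → Fin (n + 1) → ℝ} {y : Fin n → ℝ} (hx : Tendsto x f (𝓝 (doubling k y))) :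
    Tendsto (fun a => x a ∘ k.succ.succAbove) f (𝓝 y) := by
  refine tendsto_pi_nhds.2 fun l => ?_
  have := tendsto_pi_nhds.1 hx (k.succ.succAbove l)
  rwa [doubling_succAbove] at this

theorem tendsto_gapNorm {n : ℕ} {k : Fin n} {α : Type*} {f : Filter α}
    {x : α → Fin (n + 1) → ℝ} {y : Fin n → ℝ} (hx : Tendsto x f (𝓝 (doubling k y))) :
    Tendsto (fun a => gapNorm k (x a)) f (𝓝 0) := by
  have h1 : Continuous (gapNorm k) := by
    unfold gapNorm
    simp only [peakonCometric_apply]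
    fun_prop
  have h2 : gapNorm k (doubling k y) = 0 := by
    simp [gapNorm, peakonCometric_apply, doubling_succ, doubling_castSucc]
  rw [← h2]
  exact (h1.tendsto _).comp hx

theorem tendsto_schurComplement {n : ℕ} {k : Fin n} {α : Type*} {f : Filter α}
    {x : α → Fin (n + 1) → ℝ} {y : Fin n → ℝ} (hx : Tendsto x f (𝓝 (doubling k y))) :
    Tendsto (fun a => schurComplement k (x a)) f (𝓝 (peakonCometric y)) := by
  rw [← sub_zero (peakonCometric y)]
  refine ((continuous_peakonCometric.tendsto y).comp (tendsto_comp_succAbove hx)).sub ?_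
  refine tendsto_pi_nhds.2 fun i => tendsto_pi_nhds.2 fun j => ?_
  have h0 := (tendsto_gapNorm hx).div_const 4
  rw [zero_div] at h0
  refine squeeze_zero_norm (fun a => ?_) h0
  have hc := gapNorm_nonneg k (x a)
  rw [of_apply, Real.norm_eq_abs, abs_div, abs_mul, abs_of_nonneg hc]
  rcases hc.eq_or_lt with h | h
  · simp [← h]
  · rw [div_le_iff₀ h]
    have := mul_le_mul (abs_cometricColDiff_le k (x a) (k.succ.succAbove i))
      (abs_cometricColDiff_le k (x a) (k.succ.succAbove j)) (abs_nonneg _) (by positivity)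
    linarith

theorem tendsto_matrix_inv {n : ℕ} {α : Type*} {f : Filter α}
    {A : α → Matrix (Fin n) (Fin n) ℝ} {B : Matrix (Fin n) (Fin n) ℝ}
    (hA : Tendsto A f (𝓝 B)) (hB : B.det ≠ 0) : Tendsto (fun a => (A a)⁻¹) f (𝓝 B⁻¹) := by
  simp only [inv_def, Ring.inverse_eq_inv']
  exact (((continuous_id.matrix_det.tendsto B).comp hA).inv₀ hB).smul
    ((continuous_id.matrix_adjugate.tendsto B).comp hA)

theorem tendsto_schurComplement_inv {n : ℕ} {k : Fin n} {α : Type*} {f : Filter α}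
    {x : α → Fin (n + 1) → ℝ} {y : Fin n → ℝ} (hy : y ∈ orderedRegion n)
    (hx : Tendsto x f (𝓝 (doubling k y))) :
    Tendsto (fun a => (schurComplement k (x a))⁻¹) f (𝓝 (peakonMetric y)) :=
  tendsto_matrix_inv (tendsto_schurComplement hx) (posDef_peakonCometric hy).det_pos.ne'

theorem eventually_eq_schurComplement_inv_mulVec {n : ℕ} {k : Fin n} {α : Type*} {f : Filter α}
    {x : α → Fin (n + 1) → ℝ} {y : Fin n → ℝ} (hy : y ∈ orderedRegion n)
    (hx : Tendsto x f (𝓝 (doubling k y))) :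
    ∀ᶠ a in f, ∀ v, (schurComplement k (x a))⁻¹ *ᵥ (schurComplement k (x a) *ᵥ v) = v := by
  have h1 := ((continuous_id.matrix_det.tendsto _).comp (tendsto_schurComplement hx)).eventually_ne
    (posDef_peakonCometric hy).det_pos.ne'
  filter_upwards [h1] with a ha v
  have hu : IsUnit (schurComplement k (x a)).det := Ne.isUnit ha
  rw [mulVec_mulVec, nonsing_inv_mul _ hu, one_mulVec]

/-! ### The restriction of the metric to the singular set -/

/-- Tangentially to the hyperplane `{x_k = x_{k+1}}` the metric converges to the peakon metric of
the merged configuration. -/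
theorem tendsto_formValue_doubling {n : ℕ} (k : Fin n) {y : Fin n → ℝ} (hy : y ∈ orderedRegion n)
    (u w : Fin n → ℝ) :
    Tendsto (fun x => formValue (peakonMetric x) (doubling k u) (doubling k w))
      (𝓝[orderedRegion (n + 1)] (doubling k y)) (𝓝 (formValue (peakonMetric y) u w)) := by
  have hid : Tendsto id (𝓝[orderedRegion (n + 1)] (doubling k y)) (𝓝 (doubling k y)) :=
    tendsto_id'.2 nhdsWithin_le_nhds
  have hcont : Continuous fun A : Matrix (Fin n) (Fin n) ℝ => formValue A u w := by
    unfold formValue dotProduct mulVec dotProduct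
    fun_prop
  refine ((hcont.tendsto _).comp (tendsto_schurComplement_inv hy hid)).congr' ?_
  filter_upwards [eventually_eq_schurComplement_inv_mulVec hy hid, self_mem_nhdsWithin]
    with x hS hx
  have h1 := peakonCometric_mulVec_peakonMetric_mulVec hx (doubling k w)
  have h2 : schurComplement k x *ᵥ mergeMomenta k (peakonMetric x *ᵥ doubling k w) = w := by
    ext i
    rw [schurComplement_mulVec_mergeMomenta k hx, h1, doubling_succ, doubling_castSucc,
      doubling_succAbove]
    ring
  have h3 := hS (mergeMomenta k (peakonMetric x *ᵥ doubling k w))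
  simp only [id] at h3 ⊢
  rw [h2] at h3
  rw [Function.comp, formValue, formValue, doubling_dotProduct, ← h3]

theorem doubling_mem_closure {n : ℕ} (k : Fin n) {y : Fin n → ℝ} (hy : y ∈ orderedRegion n) :
    doubling k y ∈ closure (orderedRegion (n + 1)) := by
  -- move the `i`-th of the `n + 1` positions by `-i ε`
  have h : Tendsto (fun ε : ℝ => fun i : Fin (n + 1) => doubling k y i - ε * (i : ℕ))
      (𝓝[>] 0) (𝓝 (doubling k y)) := by
    refine tendsto_pi_nhds.2 fun i => ?_
    have : Tendsto (fun ε : ℝ => doubling k y i - ε * (i : ℕ)) (𝓝 0)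
        (𝓝 (doubling k y i - 0 * (i : ℕ))) := Continuous.tendsto (by fun_prop) 0
    rw [zero_mul, sub_zero] at this
    exact this.mono_left nhdsWithin_le_nhds
  refine mem_closure_of_tendsto h ?_
  filter_upwards [self_mem_nhdsWithin] with ε hε i j hij
  have h1 : doubling k y j ≤ doubling k y i :=
    StrictAnti.antitone hy (Fin.predAbove_right_monotone k hij.le)
  have h2 : ((i : ℕ) : ℝ) < (j : ℕ) := by exact_mod_cast hij
  have h3 : (0 : ℝ) < ε := hε
  have := mul_lt_mul_of_pos_left h2 h3
  linarith

theorem restrictedMetric_eq {n : ℕ} (k : Fin n) {y : Fin n → ℝ} (hy : y ∈ orderedRegion n) :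
    restrictedMetric k y = peakonMetric y := by
  ext i j
  have : (𝓝[orderedRegion (n + 1)] (doubling k y)).NeBot :=
    mem_closure_iff_nhdsWithin_neBot.1 (doubling_mem_closure k hy)
  rw [restrictedMetric, of_apply, (tendsto_formValue_doubling k hy _ _).limUnder_eq, formValue]
  simp

theorem isRiemannianMetricOn_restrictedMetric {n : ℕ} (k : Fin n) :
    IsRiemannianMetricOn (restrictedMetric k) (orderedRegion n) := by
  refine ⟨fun i j => (contDiffOn_peakonMetric i j).congr fun y hy => ?_, fun y hy => ?_⟩
  · rw [restrictedMetric_eq k hy]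
  · rw [restrictedMetric_eq k hy]
    exact posDef_peakonMetric hy

/-! ### Hamilton's equations for the momenta -/

theorem fderiv_apply_eq_sum_partialEntry {m : ℕ} (G : (Fin m → ℝ) → Matrix (Fin m) (Fin m) ℝ)
    (i j : Fin m) (x v : Fin m → ℝ) :
    fderiv ℝ (fun z => G z i j) x v = ∑ l, v l * partialEntry G l i j x := by
  conv_lhs => rw [← Finset.univ_sum_single v]
  rw [map_sum]
  refine Finset.sum_congr rfl fun l _ => ?_
  rw [partialEntry, ← smul_eq_mul, ← map_smul, ← Pi.single_smul, smul_eq_mul, mul_one]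

/-- Lowering the index in the geodesic equation: `d/dt (g_{ij} q̇^j) = ½ ∂_i g_{jl} q̇^j q̇^l`. -/
theorem IsGeodesicOn.hasDerivAt_mulVec {m : ℕ} {G : (Fin m → ℝ) → Matrix (Fin m) (Fin m) ℝ}
    {U : Set (Fin m → ℝ)} {q : ℝ → Fin m → ℝ} {I : Set ℝ} (hq : IsGeodesicOn G U q I) {t : ℝ}
    (ht : t ∈ I) (hG : ∀ i j, DifferentiableAt ℝ (fun z => G z i j) (q t))
    (hdet : IsUnit (G (q t)).det) (i : Fin m) :
    HasDerivAt (fun s => (G (q s) *ᵥ deriv q s) i)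
      ((1 / 2) * ∑ j, ∑ l, partialEntry G i j l (q t) * deriv q t j * deriv q t l) t := by
  obtain ⟨-, hd, hdd⟩ := hq t ht
  set v := deriv q t with hv
  set c : Fin m → ℝ := fun r => (1 / 2) * ∑ a, ∑ b,
    (partialEntry G a r b (q t) + partialEntry G b r a (q t) - partialEntry G r a b (q t)) *
      v a * v b with hc
  have hacc : (fun j => -∑ a, ∑ b, christoffel G (q t) j a b * v a * v b) =
      -((G (q t))⁻¹ *ᵥ c) := by
    ext j
    simp only [Pi.neg_apply, christoffel, mulVec, dotProduct, hc, Finset.mul_sum, Finset.sum_mul]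
    congr 1
    rw [Finset.sum_comm_cycle]
    refine Finset.sum_congr rfl fun r _ => Finset.sum_congr rfl fun a _ =>
      Finset.sum_congr rfl fun b _ => ?_
    ring
  have h1 : ∀ j, HasDerivAt (fun s => G (q s) i j * deriv q s j)
      ((∑ l, v l * partialEntry G l i j (q t)) * v j +
        G (q t) i j * (-((G (q t))⁻¹ *ᵥ c)) j) t := by
    intro j
    rw [hacc] at hdd
    have h2 := (hG i j).hasFDerivAt.comp_hasDerivAt t hd.hasDerivAt
    rw [fderiv_apply_eq_sum_partialEntry] at h2
    exact h2.mul (hasDerivAt_pi.1 hdd j)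
  have h3 := HasDerivAt.fun_sum (u := Finset.univ) fun j _ => h1 j
  refine h3.congr_deriv ?_
  rw [Finset.sum_add_distrib]
  have h4 : ∑ j, G (q t) i j * (-((G (q t))⁻¹ *ᵥ c)) j = -c i := by
    have : ∑ j, G (q t) i j * (-((G (q t))⁻¹ *ᵥ c)) j =
      (G (q t) *ᵥ (-((G (q t))⁻¹ *ᵥ c))) i := rfl
    rw [this, mulVec_neg, mulVec_mulVec, mul_nonsing_inv _ hdet, one_mulVec, Pi.neg_apply]
  have h5 : ∑ a, ∑ b, partialEntry G b i a (q t) * v a * v b =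
      ∑ a, ∑ b, partialEntry G a i b (q t) * v a * v b := by
    rw [Finset.sum_comm]
    exact Finset.sum_congr rfl fun _ _ => Finset.sum_congr rfl fun _ _ => by ring
  have h6 : ∑ j, (∑ l, v l * partialEntry G l i j (q t)) * v j =
      ∑ a, ∑ b, partialEntry G b i a (q t) * v a * v b := by
    refine Finset.sum_congr rfl fun _ _ => ?_
    rw [Finset.sum_mul]
    exact Finset.sum_congr rfl fun _ _ => by ring
  rw [h4, h6]
  simp only [hc, sub_mul, add_mul, Finset.sum_sub_distrib, Finset.sum_add_distrib]
  rw [h5]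
  ring

/-- The antisymmetric matrix `sgn(x_i - x_j) e^{-|x_i - x_j|}`, minus the derivative of
`h_{ij}` in the direction `x_i`. -/
noncomputable def signedCometric {m : ℕ} (x : Fin m → ℝ) : Matrix (Fin m) (Fin m) ℝ :=
  Matrix.of fun i j => (SignType.sign (x i - x j) : ℝ) * peakonCometric x i j

theorem signedCometric_swap {m : ℕ} (x : Fin m → ℝ) (i j : Fin m) :
    signedCometric x j i = -signedCometric x i j := by
  rw [signedCometric, of_apply, of_apply, peakonCometric_comm x j i, ← neg_sub (x i) (x j),
    Left.sign_neg]
  simp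

theorem abs_signedCometric_le {m : ℕ} (x : Fin m → ℝ) (i j : Fin m) :
    |signedCometric x i j| ≤ 1 := by
  have h1 : |peakonCometric x i j| ≤ 1 := by
    rw [peakonCometric_apply, abs_of_pos (Real.exp_pos _), Real.exp_le_one_iff]
    simp
  have h2 : |(SignType.sign (x i - x j) : ℝ)| ≤ 1 := by
    rcases SignType.trichotomy (SignType.sign (x i - x j)) with h | h | h <;> simp [h]
  rw [signedCometric, of_apply, abs_mul]
  exact mul_le_one₀ h2 (abs_nonneg _) h1

theorem dotProduct_signedCometric_mulVec_self {m : ℕ} (x p : Fin m → ℝ) :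
    p ⬝ᵥ (signedCometric x *ᵥ p) = 0 := by
  have h1 : (signedCometric x)ᵀ = -signedCometric x := by
    ext i j
    exact signedCometric_swap x i j
  have h2 : p ⬝ᵥ (signedCometric x *ᵥ p) = -(p ⬝ᵥ (signedCometric x *ᵥ p)) := by
    conv_lhs => rw [dotProduct_mulVec, ← mulVec_transpose, h1, neg_mulVec, neg_dotProduct,
      dotProduct_comm]
  linarith

theorem hasFDerivAt_peakonCometric {m : ℕ} {x : Fin m → ℝ} (hx : Function.Injective x)
    (i j : Fin m) :
    HasFDerivAt (fun z => peakonCometric z i j)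
      (-signedCometric x i j • (ContinuousLinearMap.proj (R := ℝ) (φ := fun _ : Fin m => ℝ) i -
        ContinuousLinearMap.proj (R := ℝ) (φ := fun _ : Fin m => ℝ) j)) x := by
  by_cases hij : i = j
  · subst hij
    simp only [peakonCometric_self, sub_self, smul_zero]
    exact hasFDerivAt_const _ _
  · have hne : x i - x j ≠ 0 := sub_ne_zero.2 fun h => hij (hx h)
    have h1 : HasFDerivAt (fun z : Fin m → ℝ => z i - z j)
        (ContinuousLinearMap.proj (R := ℝ) (φ := fun _ : Fin m => ℝ) i -
          ContinuousLinearMap.proj (R := ℝ) (φ := fun _ : Fin m => ℝ) j) x :=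
      (hasFDerivAt_apply i x).sub (hasFDerivAt_apply j x)
    have h2 := (hasDerivAt_abs hne).neg.exp.comp_hasFDerivAt x h1
    refine h2.congr_fderiv ?_
    congr 1
    simp only [signedCometric, of_apply, peakonCometric_apply, Pi.neg_apply]
    ring

theorem partialEntry_peakonCometric {m : ℕ} {x : Fin m → ℝ} (hx : Function.Injective x)
    (l i j : Fin m) :
    partialEntry peakonCometric l i j x =
      -signedCometric x i j * ((Pi.single l 1 : Fin m → ℝ) i - (Pi.single l 1 : Fin m → ℝ) j) := by
  rw [partialEntry, (hasFDerivAt_peakonCometric hx i j).fderiv]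
  simp

theorem differentiableAt_peakonMetric {m : ℕ} {x : Fin m → ℝ} (hx : x ∈ orderedRegion m)
    (i j : Fin m) : DifferentiableAt ℝ (fun z => peakonMetric z i j) x :=
  ((contDiffOn_peakonMetric i j).contDiffAt ((isOpen_orderedRegion m).mem_nhds hx)).differentiableAt
    (by simp)

/-- The derivative of the inverse matrix, `∂_i g = -g (∂_i h) g`, in the form
`(∂_i g) h = -g ∂_i h`. -/
theorem partial_peakonMetric_mul {m : ℕ} {x : Fin m → ℝ} (hx : x ∈ orderedRegion m) (i : Fin m) :
    (Matrix.of fun j l => partialEntry peakonMetric i j l x) * peakonCometric x =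
      -(peakonMetric x * Matrix.of fun j l => partialEntry peakonCometric i j l x) := by
  have hinj := injective_of_mem_orderedRegion hx
  ext j l
  have h1 : HasFDerivAt (fun z => ∑ r, peakonMetric z j r * peakonCometric z r l)
      (∑ r, (peakonMetric x j r • fderiv ℝ (fun z => peakonCometric z r l) x +
        peakonCometric x r l • fderiv ℝ (fun z => peakonMetric z j r) x)) x :=
    HasFDerivAt.fun_sum fun r _ => (differentiableAt_peakonMetric hx j r).hasFDerivAt.mul
      (hasFDerivAt_peakonCometric hinj r l).differentiableAt.hasFDerivAt
  have h2 : (fun z => ∑ r, peakonMetric z j r * peakonCometric z r l) =ᶠ[𝓝 x]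
      fun _ => (1 : Matrix (Fin m) (Fin m) ℝ) j l := by
    filter_upwards [(isOpen_orderedRegion m).mem_nhds hx] with z hz
    rw [← mul_apply, peakonMetric, nonsing_inv_mul _ (isUnit_det_peakonCometric hz)]
  have h3 := h1.unique ((hasFDerivAt_const _ x).congr_of_eventuallyEq h2)
  have h4 := congrArg (fun L => L (Pi.single i 1)) h3
  simp only [_root_.sum_apply, _root_.add_apply,
    _root_.smul_apply, _root_.zero_apply, smul_eq_mul,
    Finset.sum_add_distrib] at h4
  simp only [mul_apply, Matrix.neg_apply, of_apply, partialEntry]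
  rw [eq_neg_iff_add_eq_zero, add_comm, ← h4]
  congr 1
  exact Finset.sum_congr rfl fun _ _ => mul_comm _ _

theorem sum_partialEntry_peakonMetric {m : ℕ} {x : Fin m → ℝ} (hx : x ∈ orderedRegion m)
    (i : Fin m) (u : Fin m → ℝ) :
    ∑ j, ∑ l, partialEntry peakonMetric i j l x * u j * u l =
      2 * ((peakonMetric x *ᵥ u) i * (signedCometric x *ᵥ (peakonMetric x *ᵥ u)) i) := by
  set p := peakonMetric x *ᵥ u with hp
  have hu : peakonCometric x *ᵥ p = u := peakonCometric_mulVec_peakonMetric_mulVec hx u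
  have hform : ∀ (A : Matrix (Fin m) (Fin m) ℝ) (w : Fin m → ℝ),
      ∑ j, ∑ l, A j l * w j * w l = w ⬝ᵥ (A *ᵥ w) := by
    intro A w
    simp only [dotProduct, mulVec, Finset.mul_sum]
    exact Finset.sum_congr rfl fun _ _ => Finset.sum_congr rfl fun _ _ => by ring
  have h1 := hform (Matrix.of fun j l => partialEntry peakonMetric i j l x) u
  have h2 := hform (Matrix.of fun j l => partialEntry peakonCometric i j l x) p
  simp only [of_apply] at h1 h2
  have h3 : u ⬝ᵥ ((Matrix.of fun j l => partialEntry peakonMetric i j l x) *ᵥ u) =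
      -(p ⬝ᵥ ((Matrix.of fun j l => partialEntry peakonCometric i j l x) *ᵥ p)) := by
    have hDu : (Matrix.of fun j l => partialEntry peakonMetric i j l x) *ᵥ u =
        -(peakonMetric x * Matrix.of fun j l => partialEntry peakonCometric i j l x) *ᵥ p := by
      rw [← partial_peakonMetric_mul hx, ← mulVec_mulVec, hu]
    rw [hDu]
    rw [neg_mulVec, dotProduct_neg, ← mulVec_mulVec, dotProduct_mulVec, ← mulVec_transpose,
      peakonMetric_transpose]
  rw [h1, h3, ← h2]
  simp only [partialEntry_peakonCometric (injective_of_mem_orderedRegion hx)]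
  have h4 : ∀ j l, -signedCometric x j l *
      ((Pi.single i 1 : Fin m → ℝ) j - (Pi.single i 1 : Fin m → ℝ) l) * p j * p l =
      -((Pi.single i 1 : Fin m → ℝ) j * (p j * (signedCometric x j l * p l))) -
        (Pi.single i 1 : Fin m → ℝ) l * (p l * (signedCometric x l j * p j)) := by
    intro j l
    rw [signedCometric_swap x j l]
    ring
  simp only [h4, Finset.sum_sub_distrib, Finset.sum_neg_distrib]
  rw [Finset.sum_comm (f := fun j l =>
    (Pi.single i 1 : Fin m → ℝ) l * (p l * (signedCometric x l j * p j)))]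
  simp only [← Finset.mul_sum]
  have h5 : ∑ j, (Pi.single i 1 : Fin m → ℝ) j * (p j * ∑ l, signedCometric x j l * p l) =
      p i * ∑ l, signedCometric x i l * p l := by
    have := single_one_dotProduct i fun j => p j * ∑ l, signedCometric x j l * p l
    exact this
  rw [h5]
  simp only [mulVec, dotProduct]
  ring

section Geodesic

variable {m : ℕ} {q : ℝ → Fin m → ℝ} {I : Set ℝ}

theorem peakonCometric_mulVec_momentum
    (hq : IsGeodesicOn peakonMetric (orderedRegion m) q I) {t : ℝ} (ht : t ∈ I) :
    peakonCometric (q t) *ᵥ momentum q t = deriv q t :=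
  peakonCometric_mulVec_peakonMetric_mulVec (hq t ht).1 _

/-- Hamilton's equation `ṗ_i = p_i ∑_j sgn(q_i - q_j) e^{-|q_i - q_j|} p_j`. -/
theorem hasDerivAt_momentum (hq : IsGeodesicOn peakonMetric (orderedRegion m) q I) {t : ℝ}
    (ht : t ∈ I) (i : Fin m) :
    HasDerivAt (fun s => momentum q s i)
      (momentum q t i * (signedCometric (q t) *ᵥ momentum q t) i) t := by
  have hx := (hq t ht).1
  refine (hq.hasDerivAt_mulVec ht (differentiableAt_peakonMetric hx)
    (posDef_peakonMetric hx).det_pos.ne'.isUnit i).congr_deriv ?_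
  rw [sum_partialEntry_peakonMetric hx]
  simp only [momentum]
  ring

theorem hasDerivAt_sum_momentum (hq : IsGeodesicOn peakonMetric (orderedRegion m) q I) {t : ℝ}
    (ht : t ∈ I) : HasDerivAt (fun s => ∑ i, momentum q s i) 0 t := by
  refine (HasDerivAt.fun_sum fun i _ => hasDerivAt_momentum hq ht i).congr_deriv ?_
  exact dotProduct_signedCometric_mulVec_self (q t) (momentum q t)

theorem hasDerivAt_energy (hq : IsGeodesicOn peakonMetric (orderedRegion m) q I) {t : ℝ}
    (ht : t ∈ I) :
    HasDerivAt (fun s => momentum q s ⬝ᵥ (peakonCometric (q s) *ᵥ momentum q s)) 0 t := by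
  have hinj := injective_of_mem_orderedRegion (hq t ht).1
  set p := momentum q t with hp
  set K := signedCometric (q t) with hK
  set h := peakonCometric (q t) with hh
  set v := deriv q t with hv
  have hpv : h *ᵥ p = v := peakonCometric_mulVec_momentum hq ht
  have h1 : ∀ i j, HasDerivAt (fun s => peakonCometric (q s) i j) (-K i j * (v i - v j)) t := by
    intro i j
    have := (hasFDerivAt_peakonCometric hinj i j).comp_hasDerivAt t (hq t ht).2.1.hasDerivAt
    refine this.congr_deriv ?_
    simp [hK, hv]
  have h2 : ∀ i, HasDerivAt (fun s => (peakonCometric (q s) *ᵥ momentum q s) i)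
      (∑ j, (-K i j * (v i - v j) * p j + h i j * (p j * (K *ᵥ p) j))) t := fun i => by
    simp only [mulVec, dotProduct]
    exact HasDerivAt.fun_sum fun j _ => (h1 i j).fun_mul (hasDerivAt_momentum hq ht j)
  have h3 : HasDerivAt (fun s => momentum q s ⬝ᵥ (peakonCometric (q s) *ᵥ momentum q s))
      (∑ i, (p i * (K *ᵥ p) i * (h *ᵥ p) i +
        p i * ∑ j, (-K i j * (v i - v j) * p j + h i j * (p j * (K *ᵥ p) j)))) t :=
    HasDerivAt.fun_sum fun i _ => (hasDerivAt_momentum hq ht i).fun_mul (h2 i)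
  refine h3.congr_deriv ?_
  rw [hpv]
  set X := ∑ i, p i * (K *ᵥ p) i * v i with hX
  have e1 : ∑ i, p i * ∑ j, h i j * (p j * (K *ᵥ p) j) = X := by
    have : ∑ i, p i * ∑ j, h i j * (p j * (K *ᵥ p) j) =
        p ⬝ᵥ (h *ᵥ fun j => p j * (K *ᵥ p) j) := rfl
    rw [this, dotProduct_mulVec, ← mulVec_transpose, hh, peakonCometric_transpose, ← hh, hpv,
      dotProduct_comm]
    rfl
  have e2 : ∑ i, ∑ j, p i * (K i j * v i * p j) = X := by
    refine Finset.sum_congr rfl fun i _ => ?_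
    rw [mulVec, dotProduct, Finset.mul_sum, Finset.sum_mul]
    exact Finset.sum_congr rfl fun j _ => by ring
  have e3 : ∑ i, ∑ j, p i * (K i j * v j * p j) = -X := by
    rw [Finset.sum_comm, ← e2, ← Finset.sum_neg_distrib]
    refine Finset.sum_congr rfl fun i _ => ?_
    rw [← Finset.sum_neg_distrib]
    refine Finset.sum_congr rfl fun j _ => ?_
    rw [hK, signedCometric_swap (q t) i j]
    ring
  have e4 : ∀ i, p i * ∑ j, (-K i j * (v i - v j) * p j + h i j * (p j * (K *ᵥ p) j)) =
      (-∑ j, p i * (K i j * v i * p j)) + (∑ j, p i * (K i j * v j * p j)) +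
        p i * ∑ j, h i j * (p j * (K *ᵥ p) j) := by
    intro i
    rw [Finset.sum_add_distrib, mul_add]
    congr 1
    rw [← Finset.sum_neg_distrib, ← Finset.sum_add_distrib, Finset.mul_sum]
    exact Finset.sum_congr rfl fun j _ => by ring
  rw [Finset.sum_add_distrib, Finset.sum_congr rfl fun i _ => e4 i, Finset.sum_add_distrib,
    Finset.sum_add_distrib, Finset.sum_neg_distrib, e1, e2, e3]
  ring

theorem sum_momentum_eq {a b : ℝ} (hq : IsGeodesicOn peakonMetric (orderedRegion m) q (Ioo a b))
    {s t : ℝ} (hs : s ∈ Ioo a b) (ht : t ∈ Ioo a b) :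
    ∑ i, momentum q s i = ∑ i, momentum q t i :=
  isOpen_Ioo.is_const_of_deriv_eq_zero isPreconnected_Ioo
    (fun _ hr => (hasDerivAt_sum_momentum hq hr).differentiableAt.differentiableWithinAt)
    (fun _ hr => (hasDerivAt_sum_momentum hq hr).deriv) hs ht

theorem energy_eq {a b : ℝ} (hq : IsGeodesicOn peakonMetric (orderedRegion m) q (Ioo a b))
    {s t : ℝ} (hs : s ∈ Ioo a b) (ht : t ∈ Ioo a b) :
    momentum q s ⬝ᵥ (peakonCometric (q s) *ᵥ momentum q s) =
      momentum q t ⬝ᵥ (peakonCometric (q t) *ᵥ momentum q t) :=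
  isOpen_Ioo.is_const_of_deriv_eq_zero isPreconnected_Ioo
    (fun _ hr => (hasDerivAt_energy hq hr).differentiableAt.differentiableWithinAt)
    (fun _ hr => (hasDerivAt_energy hq hr).deriv) hs ht

theorem sq_deriv_le_energy (hq : IsGeodesicOn peakonMetric (orderedRegion m) q I) {t : ℝ}
    (ht : t ∈ I) (i : Fin m) :
    deriv q t i ^ 2 ≤ momentum q t ⬝ᵥ (peakonCometric (q t) *ᵥ momentum q t) := by
  have h := sq_dotProduct_le_of_mem_orderedRegion (hq t ht).1 (Pi.single i 1) (momentum q t)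
  rw [peakonCometric_mulVec_momentum hq ht] at h ⊢
  simpa [peakonCometric_self] using h

end Geodesic

theorem exists_tendsto_nhdsLT_of_hasDerivAt_bounded {f f' : ℝ → ℝ} {b C : ℝ}
    (h : ∀ᶠ t in 𝓝[<] b, HasDerivAt f (f' t) t ∧ |f' t| ≤ C) :
    ∃ L, Tendsto f (𝓝[<] b) (𝓝 L) := by
  obtain ⟨a, ha, hsub⟩ := mem_nhdsLT_iff_exists_Ioo_subset.1 h
  have hlip : LipschitzOnWith C.toNNReal f (Ioo a b) := by
    refine (convex_Ioo a b).lipschitzOnWith_of_nnnorm_hasDerivWithin_le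
      (fun t ht => (hsub ht).1.hasDerivWithinAt) fun t ht => ?_
    rw [← NNReal.coe_le_coe, coe_nnnorm, Real.norm_eq_abs]
    exact (hsub ht).2.trans (Real.le_coe_toNNReal C)
  obtain ⟨g, hg, hfg⟩ := hlip.extend_real
  refine ⟨g b, ((hg.continuous.tendsto b).mono_left nhdsWithin_le_nhds).congr' ?_⟩
  filter_upwards [Ioo_mem_nhdsLT ha] with t ht using (hfg ht).symm

/-! ### Behaviour at the collision -/

theorem exists_tendsto_of_isGeodesicOn {m : ℕ} {q : ℝ → Fin m → ℝ} {a b : ℝ} (hab : a < b)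
    (hq : IsGeodesicOn peakonMetric (orderedRegion m) q (Ioo a b)) :
    ∃ x, Tendsto q (𝓝[<] b) (𝓝 x) := by
  have ht₀ : (a + b) / 2 ∈ Ioo a b := ⟨by linarith, by linarith⟩
  have h : ∀ i, ∃ L, Tendsto (fun t => q t i) (𝓝[<] b) (𝓝 L) := by
    intro i
    refine exists_tendsto_nhdsLT_of_hasDerivAt_bounded (f' := fun t => deriv q t i) (C := √
      (momentum q ((a + b) / 2) ⬝ᵥ (peakonCometric (q ((a + b) / 2)) *ᵥ
        momentum q ((a + b) / 2)))) ?_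
    filter_upwards [Ioo_mem_nhdsLT hab] with t ht
    refine ⟨hasDerivAt_pi.1 (hq t ht).2.1.hasDerivAt i, Real.abs_le_sqrt ?_⟩
    rw [← energy_eq hq ht ht₀]
    exact sq_deriv_le_energy hq ht i
  choose x hx using h
  exact ⟨x, tendsto_pi_nhds.2 hx⟩

/-- The collision point has pairwise distinct positions apart from the `k`-th and `k + 1`-st. -/
theorem comp_succAbove_mem_orderedRegion {n : ℕ} {k : Fin n} {x : Fin (n + 1) → ℝ}
    (hx : Antitone x) (hgap : ∀ j : Fin n, j ≠ k → x j.succ ≠ x j.castSucc) :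
    x ∘ k.succ.succAbove ∈ orderedRegion n := by
  have hlt : ∀ j : Fin n, j ≠ k → x j.succ < x j.castSucc := fun j hj =>
    lt_of_le_of_ne (hx (Fin.castSucc_le_succ j)) (hgap j hj)
  intro i j hij
  have hJ : k.succ.succAbove i < k.succ.succAbove j := Fin.succAbove_lt_succAbove_iff.2 hij
  simp only [Function.comp]
  rcases lt_or_ge i k with hik | hik
  · -- the gap after `i` lies between the two positions
    have h1 : k.succ.succAbove i = i.castSucc := Fin.succAbove_succ_of_le _ _ hik.le
    rw [h1] at hJ ⊢
    exact (hx (Fin.castSucc_lt_iff_succ_le.1 hJ)).trans_lt (hlt i hik.ne)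
  · -- the gap before the position of `j` lies between the two positions
    have hkj := hik.trans_lt hij
    have h1 : k.succ.succAbove j = j.succ := Fin.succAbove_succ_of_lt _ _ hkj
    rw [h1] at hJ ⊢
    exact (hlt j hkj.ne').trans_le (hx (Fin.le_castSucc_iff.2 hJ))

theorem abs_signedCometric_sub_le {n : ℕ} {k : Fin n} {x : Fin (n + 1) → ℝ}
    (hx : x ∈ orderedRegion (n + 1)) {i : Fin (n + 1)} (h1 : i ≠ k.castSucc) (h2 : i ≠ k.succ) :
    |signedCometric x i k.succ - signedCometric x i k.castSucc| ≤ |cometricColDiff k x i| := by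
  -- the peakons `k` and `k + 1` lie on the same side of the peakon `i`
  rcases lt_or_gt_of_ne h1 with h | h
  · have h3 : 0 < x i - x k.castSucc := sub_pos.2 (hx h)
    have h4 : 0 < x i - x k.succ := sub_pos.2 (hx (h.trans Fin.castSucc_lt_succ))
    simp [signedCometric, cometricColDiff, sign_pos h3, sign_pos h4]
  · have h' : k.succ < i := lt_of_le_of_ne (Fin.castSucc_lt_iff_succ_le.1 h) h2.symm
    have h3 : x i - x k.castSucc < 0 := sub_neg.2 (hx h)
    have h4 : x i - x k.succ < 0 := sub_neg.2 (hx h')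
    simp only [signedCometric, cometricColDiff, of_apply, sign_neg h3, sign_neg h4]
    rw [← abs_neg]
    simp [add_comm, sub_eq_add_neg]

section Collision

variable {n : ℕ} {k : Fin n} {q : ℝ → Fin (n + 1) → ℝ} {a b : ℝ} {y : Fin n → ℝ}

theorem tendsto_cometricColDiff {α : Type*} {f : Filter α}
    {x : α → Fin (n + 1) → ℝ} (hx : Tendsto x f (𝓝 (doubling k y))) (i : Fin (n + 1)) :
    Tendsto (fun t => cometricColDiff k (x t) i) f (𝓝 0) := by
  have h0 := (tendsto_gapNorm hx).div_const 2
  rw [zero_div] at h0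
  exact squeeze_zero_norm (fun t => abs_cometricColDiff_le k (x t) i) h0

/-- Cauchy–Schwarz bounds the squared closing rate of the gap by `gapNorm` times the energy. -/
theorem tendsto_closingRate (hab : a < b)
    (hq : IsGeodesicOn peakonMetric (orderedRegion (n + 1)) q (Ioo a b))
    (hlim : Tendsto q (𝓝[<] b) (𝓝 (doubling k y))) :
    Tendsto (fun t => deriv q t k.succ - deriv q t k.castSucc) (𝓝[<] b) (𝓝 0) := by
  have ht₀ : (a + b) / 2 ∈ Ioo a b := ⟨by linarith, by linarith⟩
  set E := momentum q ((a + b) / 2) ⬝ᵥ (peakonCometric (q ((a + b) / 2)) *ᵥ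
        momentum q ((a + b) / 2)) with hE
  have h0 := ((tendsto_gapNorm hlim).mul_const E).sqrt
  rw [zero_mul, Real.sqrt_zero] at h0
  refine squeeze_zero_norm' ?_ h0
  filter_upwards [Ioo_mem_nhdsLT hab] with t ht
  refine Real.abs_le_sqrt ?_
  have h := sq_dotProduct_le_of_mem_orderedRegion (hq t ht).1
    (Pi.single k.succ 1 - Pi.single k.castSucc 1) (momentum q t)
  rw [energy_eq hq ht ht₀, ← hE, peakonCometric_mulVec_momentum hq ht] at h
  have h1 : (Pi.single k.succ 1 - Pi.single k.castSucc 1) ⬝ᵥ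
      (peakonCometric (q t) *ᵥ (Pi.single k.succ 1 - Pi.single k.castSucc 1)) =
      gapNorm k (q t) := by
    simp only [sub_dotProduct, mulVec_sub, dotProduct_sub, single_one_dotProduct, mulVec_single_one,
      col_apply, peakonCometric_self, gapNorm, peakonCometric_comm (q t) k.succ]
    ring
  simpa [h1, sub_dotProduct] using h

theorem isBigO_deriv (hab : a < b)
    (hq : IsGeodesicOn peakonMetric (orderedRegion (n + 1)) q (Ioo a b)) (i : Fin (n + 1)) :
    (fun t => deriv q t i) =O[𝓝[<] b] fun _ => (1 : ℝ) := by
  have ht₀ : (a + b) / 2 ∈ Ioo a b := ⟨by linarith, by linarith⟩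
  refine IsBigO.of_bound (√(momentum q ((a + b) / 2) ⬝ᵥ (peakonCometric (q ((a + b) / 2)) *ᵥ
        momentum q ((a + b) / 2)))) ?_
  filter_upwards [Ioo_mem_nhdsLT hab] with t ht
  rw [norm_one, mul_one]
  refine Real.abs_le_sqrt ?_
  rw [← energy_eq hq ht ht₀]
  exact sq_deriv_le_energy hq ht i

/-- The merged momenta stay bounded: they solve a linear system with bounded right-hand side, whose
matrix converges to the invertible matrix `h(y)`. -/
theorem isBigO_mergeMomenta (hab : a < b)
    (hq : IsGeodesicOn peakonMetric (orderedRegion (n + 1)) q (Ioo a b))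
    (hy : y ∈ orderedRegion n) (hlim : Tendsto q (𝓝[<] b) (𝓝 (doubling k y))) (l : Fin n) :
    (fun t => mergeMomenta k (momentum q t) l) =O[𝓝[<] b] fun _ => (1 : ℝ) := by
  have hratio : ∀ i, (fun t => cometricColDiff k (q t) i / gapNorm k (q t)) =O[𝓝[<] b]
      fun _ => (1 : ℝ) := by
    intro i
    refine IsBigO.of_bound 1 ?_
    filter_upwards [Ioo_mem_nhdsLT hab] with t ht
    have hc := gapNorm_pos k (hq t ht).1
    rw [norm_one, mul_one, norm_div, Real.norm_eq_abs, Real.norm_eq_abs, abs_of_pos hc,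
      div_le_iff₀ hc]
    linarith [abs_cometricColDiff_le k (q t) i]
  have hrhs : ∀ i, (fun t => deriv q t (k.succ.succAbove i) -
      cometricColDiff k (q t) (k.succ.succAbove i) / gapNorm k (q t) *
        (deriv q t k.succ - deriv q t k.castSucc)) =O[𝓝[<] b] fun _ => (1 : ℝ) := by
    intro i
    refine (isBigO_deriv hab hq _).sub ?_
    exact ((hratio (k.succ.succAbove i)).mul
      ((tendsto_closingRate hab hq hlim).isBigO_one ℝ)).congr_right fun _ => mul_one 1
  have hinv : ∀ j, (fun t => (schurComplement k (q t))⁻¹ l j) =O[𝓝[<] b] fun _ => (1 : ℝ) :=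
    fun j => (tendsto_pi_nhds.1 (tendsto_pi_nhds.1 (tendsto_schurComplement_inv hy hlim) l)
      j).isBigO_one ℝ
  have hsum : (fun t => ∑ j, (schurComplement k (q t))⁻¹ l j *
      (deriv q t (k.succ.succAbove j) -
        cometricColDiff k (q t) (k.succ.succAbove j) / gapNorm k (q t) *
        (deriv q t k.succ - deriv q t k.castSucc))) =O[𝓝[<] b] fun _ => (1 : ℝ) :=
    IsBigO.fun_sum fun j _ => ((hinv j).mul (hrhs j)).congr_right fun _ => mul_one 1
  refine hsum.congr' ?_ EventuallyEq.rfl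
  filter_upwards [eventually_eq_schurComplement_inv_mulVec hy hlim, Ioo_mem_nhdsLT hab]
    with t hS ht
  have h1 := congrFun (hS (mergeMomenta k (momentum q t))) l
  rw [← h1, mulVec, dotProduct]
  refine Finset.sum_congr rfl fun j _ => ?_
  rw [schurComplement_mulVec_mergeMomenta k (hq t ht).1, peakonCometric_mulVec_momentum hq ht]

/-- The single momentum `p_{k+1}` may blow up, but its products with the vanishing differences of
columns of `h` tend to zero. -/
theorem tendsto_cometricColDiff_mul_momentum (hab : a < b)
    (hq : IsGeodesicOn peakonMetric (orderedRegion (n + 1)) q (Ioo a b))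
    (hy : y ∈ orderedRegion n) (hlim : Tendsto q (𝓝[<] b) (𝓝 (doubling k y)))
    (i : Fin (n + 1)) :
    Tendsto (fun t => cometricColDiff k (q t) i * momentum q t k.succ) (𝓝[<] b) (𝓝 0) := by
  have h1 : Tendsto (fun t => (cometricColDiff k (q t) ∘ k.succ.succAbove) ⬝ᵥ
      mergeMomenta k (momentum q t)) (𝓝[<] b) (𝓝 0) := by
    rw [← isLittleO_one_iff ℝ]
    simp only [dotProduct]
    exact IsLittleO.fun_sum fun l _ => (((isLittleO_one_iff ℝ).2
      (tendsto_cometricColDiff hlim (k.succ.succAbove l))).mul_isBigO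
        (isBigO_mergeMomenta hab hq hy hlim l)).congr_right fun _ => mul_one 1
  have h2 : Tendsto (fun t => gapNorm k (q t) * momentum q t k.succ) (𝓝[<] b) (𝓝 0) := by
    have h3 := (tendsto_closingRate hab hq hlim).sub h1
    rw [sub_zero] at h3
    refine h3.congr' ?_
    filter_upwards [Ioo_mem_nhdsLT hab] with t ht
    rw [← peakonCometric_mulVec_momentum hq ht, mulVec_succ_sub_mulVec_castSucc]
    ring
  refine squeeze_zero_norm (fun t => ?_) (by simpa only [norm_zero] using h2.norm)
  rw [norm_mul, norm_mul, Real.norm_of_nonneg (gapNorm_nonneg k (q t))]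
  refine mul_le_mul_of_nonneg_right ?_ (norm_nonneg _)
  rw [Real.norm_eq_abs]
  linarith [abs_cometricColDiff_le k (q t) i, gapNorm_nonneg k (q t)]

theorem exists_tendsto_momentum (hab : a < b)
    (hq : IsGeodesicOn peakonMetric (orderedRegion (n + 1)) q (Ioo a b))
    (hy : y ∈ orderedRegion n) (hlim : Tendsto q (𝓝[<] b) (𝓝 (doubling k y)))
    {l : Fin n} (hl : l ≠ k) :
    ∃ L, Tendsto (fun t => momentum q t (k.succ.succAbove l)) (𝓝[<] b) (𝓝 L) := by
  set i := k.succ.succAbove l with hi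
  have hi2 : i ≠ k.succ := Fin.succAbove_ne _ _
  have hi1 : i ≠ k.castSucc := by
    rw [hi, ← Fin.succAbove_succ_self k]
    exact fun h => hl (Fin.succAbove_right_injective h)
  have hp : (fun t => momentum q t i) =O[𝓝[<] b] fun _ => (1 : ℝ) := by
    have := isBigO_mergeMomenta hab hq hy hlim l
    simpa [mergeMomenta, hl, ← hi] using this
  have hK : ∀ j, (fun t => signedCometric (q t) i j) =O[𝓝[<] b] fun _ => (1 : ℝ) := fun j =>
    IsBigO.of_bound 1 (Eventually.of_forall fun t => by
      simpa using abs_signedCometric_le (q t) i j)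
  have hcol : (fun t => (signedCometric (q t) i k.succ - signedCometric (q t) i k.castSucc) *
      momentum q t k.succ) =O[𝓝[<] b] fun _ => (1 : ℝ) := by
    refine IsBigO.trans (IsBigO.of_bound 1 ?_)
      ((tendsto_cometricColDiff_mul_momentum hab hq hy hlim i).isBigO_one ℝ)
    filter_upwards [Ioo_mem_nhdsLT hab] with t ht
    rw [one_mul, norm_mul, norm_mul]
    exact mul_le_mul_of_nonneg_right (abs_signedCometric_sub_le (hq t ht).1 hi1 hi2) (norm_nonneg _)
  have hsum : (fun t => (signedCometric (q t) *ᵥ momentum q t) i) =O[𝓝[<] b]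
      fun _ => (1 : ℝ) := by
    simp only [mulVec, dotProduct_eq_merge k]
    refine IsBigO.add ?_ hcol
    simp only [dotProduct]
    exact IsBigO.fun_sum fun j _ => ((hK (k.succ.succAbove j)).mul
      (isBigO_mergeMomenta hab hq hy hlim j)).congr_right fun _ => mul_one 1
  have hd := hp.mul hsum
  simp only [mul_one] at hd
  obtain ⟨C, hC⟩ := hd.bound
  refine exists_tendsto_nhdsLT_of_hasDerivAt_bounded (C := C)
    (f' := fun t => momentum q t i * (signedCometric (q t) *ᵥ momentum q t) i) ?_
  filter_upwards [hC, Ioo_mem_nhdsLT hab] with t h1 ht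
  exact ⟨hasDerivAt_momentum hq ht i, by simpa using h1⟩

/-- The merged momenta converge; for the `k`-th one this follows from the conservation of the total
momentum. -/
theorem exists_tendsto_mergeMomenta (hab : a < b)
    (hq : IsGeodesicOn peakonMetric (orderedRegion (n + 1)) q (Ioo a b))
    (hy : y ∈ orderedRegion n) (hlim : Tendsto q (𝓝[<] b) (𝓝 (doubling k y))) :
    ∃ π, Tendsto (fun t => mergeMomenta k (momentum q t)) (𝓝[<] b) (𝓝 π) := by
  have hne : ∀ l, l ≠ k → ∃ L, Tendsto (fun t => mergeMomenta k (momentum q t) l)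
      (𝓝[<] b) (𝓝 L) := by
    intro l hl
    simpa [mergeMomenta, hl] using exists_tendsto_momentum hab hq hy hlim hl
  have hk : ∃ L, Tendsto (fun t => mergeMomenta k (momentum q t) k) (𝓝[<] b) (𝓝 L) := by
    choose L hL using hne
    have ht₀ : (a + b) / 2 ∈ Ioo a b := ⟨by linarith, by linarith⟩
    refine ⟨∑ i, momentum q ((a + b) / 2) i -
      ∑ l : {l // l ≠ k}, L l.1 l.2, Tendsto.congr' ?_ (tendsto_const_nhds.sub
        (tendsto_finsetSum Finset.univ fun (l : {l // l ≠ k}) _ => hL l.1 l.2))⟩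
    filter_upwards [Ioo_mem_nhdsLT hab] with t ht
    rw [← sum_momentum_eq hq ht ht₀]
    have h1 := dotProduct_eq_merge k 1 (momentum q t)
    rw [one_dotProduct] at h1
    have h2 : ((1 : Fin (n + 1) → ℝ) ∘ k.succ.succAbove) ⬝ᵥ mergeMomenta k (momentum q t) =
        ∑ l, mergeMomenta k (momentum q t) l := one_dotProduct _
    have h3 := Fintype.sum_eq_add_sum_subtype_ne
      (fun l => mergeMomenta k (momentum q t) l) k
    rw [h1, h2, h3]
    simp
  have hall : ∀ l, ∃ L, Tendsto (fun t => mergeMomenta k (momentum q t) l) (𝓝[<] b) (𝓝 L) := by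
    intro l
    by_cases hl : l = k
    · rw [hl]; exact hk
    · exact hne l hl
  choose π hπ using hall
  exact ⟨π, tendsto_pi_nhds.2 hπ⟩

variable {π : Fin n → ℝ}

theorem tendsto_deriv_of_tendsto_mergeMomenta (hab : a < b)
    (hq : IsGeodesicOn peakonMetric (orderedRegion (n + 1)) q (Ioo a b))
    (hy : y ∈ orderedRegion n) (hlim : Tendsto q (𝓝[<] b) (𝓝 (doubling k y)))
    (hπ : Tendsto (fun t => mergeMomenta k (momentum q t)) (𝓝[<] b) (𝓝 π)) :
    Tendsto (deriv q) (𝓝[<] b) (𝓝 (doubling k (peakonCometric y *ᵥ π))) := by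
  refine tendsto_pi_nhds.2 fun i => ?_
  have h1 : Tendsto (fun t => ∑ l, peakonCometric (q t) i (k.succ.succAbove l) *
      mergeMomenta k (momentum q t) l + cometricColDiff k (q t) i * momentum q t k.succ)
      (𝓝[<] b) (𝓝 (∑ l, peakonCometric (doubling k y) i (k.succ.succAbove l) * π l + 0)) := by
    refine Tendsto.add (tendsto_finsetSum _ fun l _ => ?_)
      (tendsto_cometricColDiff_mul_momentum hab hq hy hlim i)
    exact (tendsto_pi_nhds.1 (tendsto_pi_nhds.1
      ((continuous_peakonCometric.tendsto _).comp hlim) i) _).mul (tendsto_pi_nhds.1 hπ l)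
  have h2 : ∑ l, peakonCometric (doubling k y) i (k.succ.succAbove l) * π l + 0 =
      doubling k (peakonCometric y *ᵥ π) i := by
    rw [add_zero, doubling, mulVec, dotProduct]
    refine Finset.sum_congr rfl fun l _ => ?_
    rw [peakonCometric_apply, doubling_succAbove, doubling, peakonCometric_apply]
  rw [h2] at h1
  refine h1.congr' ?_
  filter_upwards [Ioo_mem_nhdsLT hab] with t ht
  rw [← peakonCometric_mulVec_momentum hq ht, peakonCometric_mulVec_eq_merge k]
  rfl

/-- In the merged energy only the nonnegative term `gapNorm * p_{k+1} ^ 2` can be lost in the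
limit. -/
theorem energy_limit_le (hab : a < b)
    (hq : IsGeodesicOn peakonMetric (orderedRegion (n + 1)) q (Ioo a b))
    (hy : y ∈ orderedRegion n) (hlim : Tendsto q (𝓝[<] b) (𝓝 (doubling k y)))
    (hπ : Tendsto (fun t => mergeMomenta k (momentum q t)) (𝓝[<] b) (𝓝 π))
    {t : ℝ} (ht : t ∈ Ioo a b) :
    π ⬝ᵥ (peakonCometric y *ᵥ π) ≤
      momentum q t ⬝ᵥ (peakonCometric (q t) *ᵥ momentum q t) := by
  have hA := (continuous_peakonCometric.tendsto y).comp (tendsto_comp_succAbove hlim)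
  have h1 : Tendsto (fun s => mergeMomenta k (momentum q s) ⬝ᵥ
      (peakonCometric (q s ∘ k.succ.succAbove) *ᵥ mergeMomenta k (momentum q s)))
      (𝓝[<] b) (𝓝 (π ⬝ᵥ (peakonCometric y *ᵥ π))) := by
    simp only [mulVec, dotProduct]
    exact tendsto_finsetSum _ fun i _ => (tendsto_pi_nhds.1 hπ i).mul <| tendsto_finsetSum _ fun j _ =>
      (tendsto_pi_nhds.1 (tendsto_pi_nhds.1 hA i) j).mul (tendsto_pi_nhds.1 hπ j)
  have h2 : Tendsto (fun s => 2 * ∑ l, cometricColDiff k (q s) (k.succ.succAbove l) *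
      momentum q s k.succ * mergeMomenta k (momentum q s) l) (𝓝[<] b)
      (𝓝 (2 * ∑ l, 0 * π l)) :=
    (tendsto_finsetSum _ fun l _ => (tendsto_cometricColDiff_mul_momentum hab hq hy hlim _).mul
      (tendsto_pi_nhds.1 hπ l)).const_mul 2
  have h3 := h1.add h2
  simp only [zero_mul, Finset.sum_const_zero, mul_zero, add_zero] at h3
  refine le_of_tendsto h3 ?_
  filter_upwards [Ioo_mem_nhdsLT hab] with s hs
  rw [← energy_eq hq hs ht, dotProduct_mulVec_eq_merge k]
  have h4 : 2 * momentum q s k.succ * ((cometricColDiff k (q s) ∘ k.succ.succAbove) ⬝ᵥ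
      mergeMomenta k (momentum q s)) = 2 * ∑ l, cometricColDiff k (q s) (k.succ.succAbove l) *
      momentum q s k.succ * mergeMomenta k (momentum q s) l := by
    rw [dotProduct, mul_assoc, Finset.mul_sum]
    congr 1
    exact Finset.sum_congr rfl fun l _ => by simp only [Function.comp]; ring
  rw [h4]
  have h5 := mul_nonneg (gapNorm_nonneg k (q s)) (sq_nonneg (momentum q s k.succ))
  linarith

end Collision

theorem lemma4 (n : ℕ) (k : Fin n) :
    -- the restriction of `g` to the singular set exists as a limit and is a Riemannian metric
    ((∀ y ∈ orderedRegion n, ∀ u w : Fin n → ℝ,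
        Tendsto (fun x => formValue (peakonMetric x) (doubling k u) (doubling k w))
          (𝓝[orderedRegion (n + 1)] (doubling k y))
          (𝓝 (formValue (restrictedMetric k y) u w))) ∧
      IsRiemannianMetricOn (restrictedMetric k) (orderedRegion n)) ∧
    -- behaviour of a geodesic for which exactly the gap `q_k - q_{k+1}` closes at time `tstar`
    ∀ (q : ℝ → Fin (n + 1) → ℝ) (a tstar : ℝ), a < tstar →
      IsGeodesicOn peakonMetric (orderedRegion (n + 1)) q (Ioo a tstar) →
      Tendsto (fun t => q t k.castSucc - q t k.succ) (𝓝[<] tstar) (𝓝 0) →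
      (∀ j : Fin n, j ≠ k →
        ¬ Tendsto (fun t => q t j.castSucc - q t j.succ) (𝓝[<] tstar) (𝓝 0)) →
      (∃ L : ℝ, Tendsto (fun t => momentum q t k.castSucc + momentum q t k.succ)
        (𝓝[<] tstar) (𝓝 L)) ∧
      (∀ j : Fin (n + 1), j ≠ k.castSucc → j ≠ k.succ →
        ∃ L : ℝ, Tendsto (fun t => momentum q t j) (𝓝[<] tstar) (𝓝 L)) ∧
      -- `y` is the parameter of the collision point, `V` the limit velocity, tangent to the
      -- singular set with coordinates `v`
      ∃ y ∈ orderedRegion n, ∃ (V : Fin (n + 1) → ℝ) (v : Fin n → ℝ),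
        Tendsto q (𝓝[<] tstar) (𝓝 (doubling k y)) ∧
        Tendsto (deriv q) (𝓝[<] tstar) (𝓝 V) ∧
        V k.castSucc = V k.succ ∧
        V = doubling k v ∧
        ∀ t ∈ Ioo a tstar,
          formValue (restrictedMetric k y) v v ≤
            formValue (peakonMetric (q t)) (deriv q t) (deriv q t) := by
  refine ⟨⟨fun y hy u w => ?_, isRiemannianMetricOn_restrictedMetric k⟩, ?_⟩
  · rw [restrictedMetric_eq k hy]
    exact tendsto_formValue_doubling k hy u w
  intro q a b hab hq hk hj
  obtain ⟨x, hx⟩ := exists_tendsto_of_isGeodesicOn hab hq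
  have hcomp := tendsto_pi_nhds.1 hx
  have hanti : Antitone x := fun i j hij => le_of_tendsto_of_tendsto (hcomp j) (hcomp i) <| by
    filter_upwards [Ioo_mem_nhdsLT hab] with t ht using StrictAnti.antitone (hq t ht).1 hij
  have hxk : x k.castSucc = x k.succ :=
    sub_eq_zero.1 (tendsto_nhds_unique ((hcomp _).sub (hcomp _)) hk)
  have hy : x ∘ k.succ.succAbove ∈ orderedRegion n :=
    comp_succAbove_mem_orderedRegion hanti fun j hjk h => hj j hjk <| by
      have := (hcomp j.castSucc).sub (hcomp j.succ)
      rwa [h, sub_self] at this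
  rw [eq_doubling hxk] at hx
  set y := x ∘ k.succ.succAbove
  obtain ⟨π, hπ⟩ := exists_tendsto_mergeMomenta hab hq hy hx
  refine ⟨⟨π k, ?_⟩, fun j hj1 hj2 => ?_, y, hy, doubling k (peakonCometric y *ᵥ π),
    peakonCometric y *ᵥ π, hx, tendsto_deriv_of_tendsto_mergeMomenta hab hq hy hx hπ,
    by rw [doubling_castSucc, doubling_succ], rfl, fun t ht => ?_⟩
  · simpa [mergeMomenta] using tendsto_pi_nhds.1 hπ k
  · obtain ⟨l, rfl⟩ := Fin.exists_succAbove_eq hj2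
    refine exists_tendsto_momentum hab hq hy hx ?_
    rintro rfl
    exact hj1 (Fin.succAbove_succ_self l)
  · have h1 : formValue (peakonMetric (q t)) (deriv q t) (deriv q t) =
        momentum q t ⬝ᵥ (peakonCometric (q t) *ᵥ momentum q t) := by
      rw [peakonCometric_mulVec_momentum hq ht, dotProduct_comm]
      rfl
    have h2 : peakonMetric y *ᵥ (peakonCometric y *ᵥ π) = π := by
      rw [mulVec_mulVec, peakonMetric, nonsing_inv_mul _ (isUnit_det_peakonCometric hy), one_mulVec]
    rw [h1, restrictedMetric_eq k hy, formValue, h2, dotProduct_comm]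
    exact energy_limit_le hab hq hy hx hπ ht
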